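/- Let $E$ and $F$ be real locally convex spaces, and work in a sufficiently saturated nonstandard extension ($\kappa$-saturated for some uncountable cardinal $\kappa$ greater than the number of continuous seminorms on $E$). For a locally convex space $X$ put $X_f=\{x\in X^*: p(x)\text{ is a finite hyperreal for every continuous seminorm }p\text{ on }X\}$ and $\mu(X)=\{x\in X^*: p(x)\text{ is infinitesimal for every continuous seminorm }p\text{ on }X\}$; write $x\sim y$ if $x-y\in\mu(X)$. The nonstandard hull is $\hat X=X_f/\mu(X)$, with classes $[\![x]\!]$ and with the locally convex topology defined by the seminorms $\hat p([\![x]\!])=\operatorname{st}(p(x))$, $p$ a continuous seminorm on $X$. Let $U\subseteq E$ be open, presented as $U=\bigcup_{i\in I}\bigcap_{j=1}^{n_i}\{x\in E: p_{ij}(x-x_{ij})<\epsilon_{ij}\}$ with continuous seminorms $p_{ij}$ on $E$, points $x_{ij}\in E$ and reals $\epsilon_{ij}>0$, and put $\hat U=\bigcup_{i\in I}\bigcap_{j=1}^{n_i}\{\xi\in\hat E:\hat p_{ij}(\xi-[\![x_{ij}]\!])<\epsilon_{ij}\}$. Let $\operatorname{int}(U^*)$ be the set of $a\in U^*$ such that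 every $b\in E^*$ with $b\sim a$ lies in $U^*$. Let $f:U\to F$ be finite, i.e. $f(U^*\cap E_f)\subseteq F_f$. For $k\ge 1$, $f$ is called uniformly $C^k$ at finite points if there are maps $d^jf$ ($1\le j\le k$) from $U$ to the space of $j$-linear maps $E^j\to F$ such that, with $d^0f=f$, for all $0\le j<k$ and all $a\in\operatorname{int}(U^*)\cap E_f$: $d^{j+1}f(a)$ maps $(E_f)^{j+1}$ into $F_f$, and $$\frac1\delta\bigl(d^jf(a+\delta x)(h)-d^jf(a)(h)\bigr)\sim d^{j+1}f(a)(h,x)$$ for all $x\in E_f$, $h\in(E_f)^j$ and all positive infinitesimal $\delta$. It is called uniformly smooth at finite points if it is uniformly $C^k$ at finite points for every $k\ge1$. If $f$ is uniformly $C^k$ at finite points, $k\geq 1$, then $\hat f([\![a]\!])=[\![f(a)]\!]$ defines a map $\hat f:\hat U\to\hat F$, this map is $C^k$ in the sense of Bastiani (it is continuous, and for $1\le j\le k$ the iterated directional derivatives $d^j\hat f(\alpha)(\eta_1,\dots,\eta_j)=(D_{\eta_j}\cdots D_{\eta_1}\hat f)(\alpha)$ exist and define continuous maps $\hat U\times\hat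 E^j\to\hat F$), and $$d^k\hat f([\![a]\!])([\![h_1]\!],\dots,[\![h_k]\!])=[\![d^kf(a)(h_1,\dots,h_k)]\!]$$ whenever $[\![a]\!]\in\hat U$ and $h_1,\dots,h_k\in E_f$. In particular, if $f$ is uniformly smooth at finite points, then $\hat f$ is smooth, i.e. $C^k$ for every $k$. -/

import Mathlib

open Filter Topology
open scoped Cardinal

universe u v w x

/-! ### Nonstandard extensions

Nonstandard extensions are taken in their general form as limit ultrapowers: the data are an
ultrafilter `D` on an index set `ι` and a filter `G` on `ι × ι`, and the nonstandard extension of a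
set `X` consists of the classes modulo `D` of the functions `s : ι → X` whose kernel
`{(i, j) | s i = s j}` belongs to `G`.  For `G = ⊥` every function is allowed and one obtains the
ultrapowers.  By Keisler's theorem the limit ultrapowers are, up to isomorphism, exactly
the extensions that satisfy the transfer principle. -/

/-- The data of a nonstandard extension (a limit ultrapower). -/
structure NonstandardExtension where
  /-- the index set -/
  ι : Type w
  /-- the ultrafilter -/
  D : Ultrafilter ι
  /-- the filter of admissible kernels (`⊥` for an ultrapower) -/
  G : Filter (ι × ι)

namespace NonstandardExtension

variable (N : NonstandardExtension.{w})

/-- A function on the index set is admissible if its kernel belongs to `G`. -/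
def Admissible {X : Type*} (s : N.ι → X) : Prop :=
  {ij : N.ι × N.ι | s ij.1 = s ij.2} ∈ N.G

/-- The nonstandard extension `X*` of a set `X`. -/
def Star (X : Type u) : Type (max u w) :=
  {y : Germ (N.D : Filter N.ι) X // ∃ s : N.ι → X, N.Admissible s ∧ (s : Germ (N.D : Filter N.ι) X) = y}

variable {N}

theorem Admissible.const {X : Type*} (c : X) : N.Admissible (fun _ => c) := by
  simp [Admissible]

theorem Admissible.comp {X Y : Type*} {s : N.ι → X} (hs : N.Admissible s) (g : X → Y) :
    N.Admissible (fun i => g (s i)) :=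
  Filter.mem_of_superset hs fun _ h => congrArg g h

theorem Admissible.comp₂ {X Y Z : Type*} {s : N.ι → X} {t : N.ι → Y} (hs : N.Admissible s)
    (ht : N.Admissible t) (g : X → Y → Z) : N.Admissible (fun i => g (s i) (t i)) :=
  Filter.mem_of_superset (Filter.inter_mem hs ht) fun _ h => congrArg₂ g h.1 h.2

theorem Admissible.pi {X : Type*} {k : ℕ} {s : Fin k → N.ι → X} (hs : ∀ j, N.Admissible (s j)) :
    N.Admissible (fun i j => s j i) := by
  have h : (⋂ j, {ij : N.ι × N.ι | s j ij.1 = s j ij.2}) ∈ N.G := Filter.iInter_mem.2 hs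
  exact Filter.mem_of_superset h fun _ h => funext fun j => Set.mem_iInter.1 h j

/-- The class of an admissible function. -/
def Star.mk {X : Type*} (s : N.ι → X) (hs : N.Admissible s) : N.Star X :=
  ⟨(s : Germ (N.D : Filter N.ι) X), s, hs, rfl⟩

/-- The nonstandard extension of a function. -/
def Star.map {X Y : Type*} (g : X → Y) (a : N.Star X) : N.Star Y :=
  ⟨Germ.map g a.1, by obtain ⟨s, hs, h⟩ := a.2; exact ⟨_, hs.comp g, by rw [← h]; rfl⟩⟩

/-- The nonstandard extension of a function of two variables. -/
def Star.map₂ {X Y Z : Type*} (g : X → Y → Z) (a : N.Star X) (b : N.Star Y) : N.Star Z :=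
  ⟨Germ.map₂ g a.1 b.1, by
    obtain ⟨s, hs, h⟩ := a.2
    obtain ⟨t, ht, h'⟩ := b.2
    exact ⟨_, hs.comp₂ ht g, by rw [← h, ← h']; rfl⟩⟩

/-- The canonical identification of `k`-tuples of elements of `X*` with elements of `(X ^ k)*`. -/
noncomputable def Star.tuple {X : Type*} {k : ℕ} (h : Fin k → N.Star X) : N.Star (Fin k → X) :=
  Star.mk (fun i j => (h j).2.choose i) (Admissible.pi fun j => (h j).2.choose_spec.1)

theorem Star.tuple_mk {X : Type*} {k : ℕ} (s : Fin k → N.ι → X) (hs : ∀ j, N.Admissible (s j)) :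
    Star.tuple (fun j => Star.mk (s j) (hs j)) = Star.mk (fun i j => s j i) (Admissible.pi hs) := by
  apply Subtype.ext
  refine Germ.coe_eq.2 ?_
  have h : ∀ j, ∀ᶠ i in (N.D : Filter N.ι),
      ((Star.mk (s j) (hs j) : N.Star X)).2.choose i = s j i := fun j =>
    Germ.coe_eq.1 ((Star.mk (s j) (hs j) : N.Star X)).2.choose_spec.2
  filter_upwards [eventually_all.2 h] with i hi
  exact funext hi

variable (N)

/-- The embedding of `X` in `X*`. -/
def std {X : Type*} (c : X) : N.Star X :=
  Star.mk (fun _ => c) (Admissible.const c)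

/-- The nonstandard extension `A*`, a subset of `X*`, of a subset `A` of `X`. -/
def starSet {X : Type*} (A : Set X) : Set (N.Star X) :=
  {a | Germ.LiftPred (· ∈ A) a.1}

/-- The internal subset of `X*` given by an element of the nonstandard extension of the power set
of `X`. -/
def internalSet {X : Type*} (A : N.Star (Set X)) : Set (N.Star X) :=
  {a | Germ.LiftRel (· ∈ ·) a.1 A.1}

/-- `κ`-saturation: a family of fewer than `κ` internal sets with the finite intersection property
has nonempty intersection. -/
def IsSaturated (κ : Cardinal.{u}) : Prop :=
  ∀ (X J : Type u) (A : J → N.Star (Set X)), #J < κ →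
    (∀ s : Finset J, (⋂ j ∈ s, N.internalSet (A j)).Nonempty) →
    (⋂ j, N.internalSet (A j)).Nonempty

variable {N}

/-! ### Hyperreal numbers -/

/-- The hyperreal number `y` is finite (limited). -/
def IsLimited (y : N.Star ℝ) : Prop :=
  ∃ r : ℝ, y ∈ N.starSet {s | |s| ≤ r}

/-- The hyperreal number `y` is infinitesimal. -/
def IsInfinitesimal (y : N.Star ℝ) : Prop :=
  ∀ r : ℝ, 0 < r → y ∈ N.starSet {s | |s| < r}

/-- The standard part of a finite hyperreal number. -/
noncomputable def st (y : N.Star ℝ) : ℝ :=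
  ArchimedeanClass.stdPart y.1

theorem IsInfinitesimal.isLimited {y : N.Star ℝ} (h : IsInfinitesimal y) : IsLimited y :=
  ⟨1, by
    obtain ⟨⟨s⟩, hs⟩ := y
    exact (h 1 one_pos).mono fun i (hi : |s i| < 1) => hi.le⟩

/-- The embedding of the real numbers in an ultrapower. -/
noncomputable def constHom : ℝ →+*o Germ (N.D : Filter N.ι) ℝ where
  toFun r := ((r : ℝ) : Germ (N.D : Filter N.ι) ℝ)
  map_one' := rfl
  map_mul' _ _ := rfl
  map_zero' := rfl
  map_add' _ _ := rfl
  monotone' _ _ h := Germ.const_le h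

theorem st_spec {y : N.Star ℝ} (hy : IsLimited y) {ε : ℝ} (hε : 0 < ε) :
    y ∈ N.starSet {s | |s - st y| < ε} := by
  obtain ⟨r, hr⟩ := hy
  obtain ⟨y, hy⟩ := y
  have hr' : |y| ≤ (constHom r : Germ (N.D : Filter N.ι) ℝ) := by
    induction y using Germ.inductionOn with
    | h s => exact hr
  have h0 : 0 ≤ ArchimedeanClass.mk y := by
    refine (ArchimedeanClass.mk_map_nonneg_of_archimedean (constHom (N := N)) r).trans ?_
    exact ArchimedeanClass.mk_le_mk_of_abs (hr'.trans (le_abs_self _))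
  have h1 := ArchimedeanClass.lt_of_lt_stdPart constHom (r := st ⟨y, hy⟩ - ε) h0
    (by simp only [st]; linarith)
  have h2 := ArchimedeanClass.lt_of_stdPart_lt constHom (r := st ⟨y, hy⟩ + ε) h0
    (by simp only [st]; linarith)
  generalize st ⟨y, hy⟩ = c at h1 h2 ⊢
  induction y using Germ.inductionOn with
  | h s =>
    filter_upwards [Germ.coe_lt.1 h1, Germ.coe_lt.1 h2] with i hi1 hi2
    refine abs_lt.2 ?_
    constructor <;> linarith

/-! ### Finite and infinitesimal vectors, the nonstandard hull -/

section Module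

variable {E : Type u} [AddCommGroup E] [Module ℝ E]

variable (N E) in
/-- `E*` as a real subspace of the ultrapower of `E`. -/
def starSubmodule : Submodule ℝ (Germ (N.D : Filter N.ι) E) where
  carrier := {y | ∃ s : N.ι → E, N.Admissible s ∧ (s : Germ (N.D : Filter N.ι) E) = y}
  add_mem' := by
    rintro _ _ ⟨s, hs, rfl⟩ ⟨t, ht, rfl⟩
    exact ⟨_, hs.comp₂ ht (· + ·), rfl⟩
  zero_mem' := ⟨_, Admissible.const 0, rfl⟩
  smul_mem' := by
    rintro c _ ⟨s, hs, rfl⟩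
    exact ⟨_, hs.comp (c • ·), rfl⟩

noncomputable instance : AddCommGroup (N.Star E) :=
  inferInstanceAs (AddCommGroup (N.starSubmodule E))

noncomputable instance : Module ℝ (N.Star E) :=
  inferInstanceAs (Module ℝ (N.starSubmodule E))

/-- The internal scalar multiplication of `E*` by hyperreal numbers. -/
def hsmul (δ : N.Star ℝ) (y : N.Star E) : N.Star E :=
  Star.map₂ (fun t z => t • z) δ y

/-- The quotient `(1 / δ) y` of a vector by a hyperreal number. -/
noncomputable def hdiv (y : N.Star E) (δ : N.Star ℝ) : N.Star E :=
  Star.map₂ (fun t z => t⁻¹ • z) δ y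

variable [TopologicalSpace E]

variable (N E) in
/-- The space `E_f` of finite points of `E*`. -/
def finitePart : Submodule ℝ (N.Star E) where
  carrier := {y | ∀ p : Seminorm ℝ E, Continuous p → IsLimited (Star.map p y)}
  add_mem' := by
    rintro ⟨⟨s⟩, hs⟩ ⟨⟨t⟩, ht⟩ h h' p hp
    obtain ⟨r, hr⟩ := h p hp
    obtain ⟨r', hr'⟩ := h' p hp
    refine ⟨r + r', ?_⟩
    filter_upwards [hr, hr'] with i hi hi'
    simp only [Function.comp_apply, abs_of_nonneg (apply_nonneg p _)] at hi hi' ⊢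
    exact (map_add_le_add p _ _).trans (add_le_add hi hi')
  zero_mem' := by
    intro p _
    exact ⟨0, Eventually.of_forall fun i => by simp⟩
  smul_mem' := by
    rintro c ⟨⟨s⟩, hs⟩ h p hp
    obtain ⟨r, hr⟩ := h p hp
    refine ⟨|c| * r, ?_⟩
    filter_upwards [hr] with i hi
    simp only [Function.comp_apply, abs_of_nonneg (apply_nonneg p _)] at hi ⊢
    rw [map_smul_eq_mul, Real.norm_eq_abs]
    gcongr

variable (N E) in
/-- The space `μ(E)` of infinitesimal points of `E*`. -/
def monad : Submodule ℝ (N.Star E) where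
  carrier := {y | ∀ p : Seminorm ℝ E, Continuous p → IsInfinitesimal (Star.map p y)}
  add_mem' := by
    rintro ⟨⟨s⟩, hs⟩ ⟨⟨t⟩, ht⟩ h h' p hp r hr
    filter_upwards [h p hp (r / 2) (half_pos hr), h' p hp (r / 2) (half_pos hr)] with i hi hi'
    simp only [Function.comp_apply, abs_of_nonneg (apply_nonneg p _)] at hi hi' ⊢
    exact (map_add_le_add p _ _).trans_lt (by linarith)
  zero_mem' := by
    intro p _ r hr
    exact Eventually.of_forall fun i => by simpa using hr
  smul_mem' := by
    rintro c ⟨⟨s⟩, hs⟩ h p hp r hr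
    have hc : 0 < |c| + 1 := by positivity
    filter_upwards [h p hp (r / (|c| + 1)) (by positivity)] with i hi
    simp only [Function.comp_apply, abs_of_nonneg (apply_nonneg p _)] at hi ⊢
    rw [map_smul_eq_mul, Real.norm_eq_abs]
    rw [lt_div_iff₀ hc] at hi
    have := apply_nonneg p (s i)
    nlinarith

/-- `a ∼ b`: the points `a` and `b` of `E*` are infinitely close. -/
def Near (a b : N.Star E) : Prop :=
  a - b ∈ N.monad E

variable (N E) in
/-- The nonstandard hull `Ê = E_f / μ(E)` (every infinitesimal point is finite). -/
def Hull : Type (max u w) :=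
  N.finitePart E ⧸ (N.monad E).comap (N.finitePart E).subtype

noncomputable instance : AddCommGroup (N.Hull E) :=
  inferInstanceAs (AddCommGroup (N.finitePart E ⧸ (N.monad E).comap (N.finitePart E).subtype))

noncomputable instance : Module ℝ (N.Hull E) :=
  inferInstanceAs (Module ℝ (N.finitePart E ⧸ (N.monad E).comap (N.finitePart E).subtype))

/-- The class `⟦a⟧` in `Ê` of a finite point `a`. -/
noncomputable def cls (a : N.finitePart E) : N.Hull E :=
  Submodule.Quotient.mk (p := (N.monad E).comap (N.finitePart E).subtype) a

theorem std_mem_finitePart (c : E) : N.std c ∈ N.finitePart E := fun p _ =>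
  ⟨|p c|, Eventually.of_forall fun _ => le_refl |p c|⟩

/-- The class `⟦c⟧` in `Ê` of a standard point `c`. -/
noncomputable def stdCls (c : E) : N.Hull E :=
  cls ⟨N.std c, std_mem_finitePart c⟩

/-- The seminorm `x ↦ st (p x)` on the finite points. -/
noncomputable def finSeminorm (p : Seminorm ℝ E) (hp : Continuous p) :
    Seminorm ℝ (N.finitePart E) :=
  Seminorm.ofSMulLE (fun y => st (Star.map p y.1))
    (by
      refine le_antisymm (le_of_forall_pos_le_add fun ε hε => ?_)
        (le_of_forall_pos_le_add fun ε hε => ?_) <;>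
      · obtain ⟨i, hi⟩ := Eventually.exists (f := (N.D : Filter N.ι))
          (st_spec ((0 : N.finitePart E).2 p hp) hε)
        have hi' : |p 0 - st (Star.map p (0 : N.finitePart E).1)| < ε := hi
        rw [map_zero, abs_lt] at hi'
        linarith [hi'.1, hi'.2])
    (by
      rintro ⟨⟨⟨s⟩, hs⟩, h⟩ ⟨⟨⟨t⟩, ht⟩, h'⟩
      refine le_of_forall_pos_le_add fun ε hε => ?_
      have e1 := st_spec (h p hp) (ε := ε / 3) (by positivity)
      have e2 := st_spec (h' p hp) (ε := ε / 3) (by positivity)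
      have e3 := st_spec (((N.finitePart E).add_mem h h') p hp) (ε := ε / 3) (by positivity)
      obtain ⟨i, ⟨h1, h2⟩, h3⟩ := Eventually.exists (f := (N.D : Filter N.ι)) ((e1.and e2).and e3)
      have h1' := abs_lt.1 (Set.mem_ofPred.1 h1)
      have h2' := abs_lt.1 (Set.mem_ofPred.1 h2)
      have h3' := abs_lt.1 (Set.mem_ofPred.1 h3)
      have h4 : p (s i + t i) ≤ p (s i) + p (t i) := map_add_le_add p _ _
      simp only [Function.comp_apply] at h1' h2' h3'
      change _ < p (s i + t i) - st (Star.map p (_ + _)) ∧ _ at h3'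
      change st (Star.map p (_ + _)) ≤ _
      linarith [h1'.1, h1'.2, h2'.1, h2'.2, h3'.1, h3'.2])
    (by
      rintro c ⟨⟨⟨s⟩, hs⟩, h⟩
      refine le_of_forall_pos_le_add fun ε hε => ?_
      have hc : 0 < |c| + 1 := by positivity
      have e1 := st_spec (h p hp) (ε := ε / 2 / (|c| + 1)) (by positivity)
      have e3 := st_spec (((N.finitePart E).smul_mem c h) p hp) (ε := ε / 2) (by positivity)
      obtain ⟨i, h1, h3⟩ := Eventually.exists (f := (N.D : Filter N.ι)) (e1.and e3)
      have h1' := abs_lt.1 (Set.mem_ofPred.1 h1)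
      have h3' := abs_lt.1 (Set.mem_ofPred.1 h3)
      have h4 : p (c • s i) = |c| * p (s i) := by rw [map_smul_eq_mul, Real.norm_eq_abs]
      simp only [Function.comp_apply] at h1' h3'
      change _ < p (c • s i) - st (Star.map p (c • _)) ∧ _ at h3'
      change st (Star.map p (c • _)) ≤ ‖c‖ * _ + ε
      rw [Real.norm_eq_abs]
      have h5 : (|c| + 1) * (ε / 2 / (|c| + 1)) = ε / 2 := by field_simp
      have h6 := mul_le_mul_of_nonneg_left h1'.2.le (abs_nonneg c)
      have h7 : 0 ≤ ε / 2 / (|c| + 1) := by positivity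
      nlinarith [h3'.1, h3'.2])

theorem finSeminorm_eq_zero {p : Seminorm ℝ E} (hp : Continuous p) (y : N.finitePart E)
    (hy : y.1 ∈ N.monad E) : finSeminorm p hp y = 0 := by
  refine le_antisymm (le_of_forall_pos_le_add fun ε hε => ?_) (apply_nonneg _ _)
  obtain ⟨⟨⟨s⟩, hs⟩, h⟩ := y
  have e1 := st_spec (h p hp) (ε := ε / 2) (by positivity)
  obtain ⟨i, h1, h2⟩ := Eventually.exists (f := (N.D : Filter N.ι))
    (e1.and (hy p hp (ε / 2) (by positivity)))
  have h1' := abs_lt.1 (Set.mem_ofPred.1 h1)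
  have h2' := abs_lt.1 (Set.mem_ofPred.1 h2)
  change st _ ≤ _
  linarith [h1'.1, h2'.2]

/-- The seminorm `p̂ ⟦x⟧ = st (p x)` on the nonstandard hull. -/
noncomputable def hullSeminorm (p : Seminorm ℝ E) (hp : Continuous p) : Seminorm ℝ (N.Hull E) :=
  Seminorm.ofSMulLE
    (fun ξ => Quotient.liftOn' ξ (fun y => finSeminorm p hp y) (by
      intro a b hab
      have hab' : a - b ∈ (N.monad E).comap (N.finitePart E).subtype :=
        (Submodule.quotientRel_def _).1 hab
      have h0 := finSeminorm_eq_zero hp (a - b) hab'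
      have h1 := abs_sub_map_le_sub (finSeminorm p hp) a b
      rw [h0] at h1
      exact sub_eq_zero.1 (abs_nonpos_iff.1 h1)))
    (map_zero (finSeminorm (N := N) p hp))
    (by
      rintro ⟨a⟩ ⟨b⟩
      exact map_add_le_add (finSeminorm p hp) a b)
    (by
      rintro c ⟨a⟩
      exact (map_smul_eq_mul (finSeminorm p hp) c a).le)

theorem hullSeminorm_cls (p : Seminorm ℝ E) (hp : Continuous p) (a : N.finitePart E) :
    hullSeminorm p hp (cls a) = st (Star.map p a.1) :=
  rfl

/-- The topology of the nonstandard hull: the locally convex topology defined by the seminorms `p̂`,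
for all continuous seminorms `p`. -/
noncomputable instance : TopologicalSpace (N.Hull E) :=
  (SeminormFamily.moduleFilterBasis (𝕜 := ℝ)
    (fun p : {p : Seminorm ℝ E // Continuous p} => hullSeminorm (N := N) p.1 p.2)).topology

end Module

end NonstandardExtension

/-! ### Differentiability in the sense of Bastiani -/

section Bastiani

variable {X : Type u} {Y : Type v} [AddCommGroup X] [Module ℝ X] [TopologicalSpace X]
  [AddCommGroup Y] [Module ℝ Y] [TopologicalSpace Y]

/-- The maps `D j : V × X ^ j → Y`, for `j ≤ k`, are the iterated directional derivatives
`D j a (h₁, …, h_j) = (D_{h_j} ⋯ D_{h₁} g) a` of the map `g : V → Y` on the open set `V`, and they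
are continuous.  (Only the values of `g` on `V` and of `D j` on `V × X ^ j` matter.) -/
structure HasBastianiDerivs (k : ℕ) (g : X → Y) (V : Set X)
    (D : (j : ℕ) → X → (Fin j → X) → Y) : Prop where
  zero : ∀ a ∈ V, ∀ h : Fin 0 → X, D 0 a h = g a
  succ : ∀ j < k, ∀ a ∈ V, ∀ (h : Fin j → X) (y : X),
    Tendsto (fun t : ℝ => t⁻¹ • (D j (a + t • y) h - D j a h)) (𝓝[≠] 0)
      (𝓝 (D (j + 1) a (Fin.snoc h y)))
  cont : ∀ j ≤ k, ContinuousOn (fun q : X × (Fin j → X) => D j q.1 q.2) (V ×ˢ Set.univ)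

/-- `g` is of class `C^k` in the sense of Bastiani on the open set `V`. -/
def IsBastianiCk (k : ℕ) (g : X → Y) (V : Set X) : Prop :=
  ∃ D : (j : ℕ) → X → (Fin j → X) → Y, HasBastianiDerivs k g V D

/-- `g` is smooth in the sense of Bastiani on the open set `V`. -/
def IsBastianiSmooth (g : X → Y) (V : Set X) : Prop :=
  ∀ k : ℕ, IsBastianiCk k g V

end Bastiani

/-! ### Presentations of open sets by seminorm balls -/

/-- A presentation of `U` as a union of finite intersections of open seminorm balls
`{x | p i j (x - c i j) < ε i j}`, for continuous seminorms `p i j`. -/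
structure BallPresentation {E : Type u} [AddCommGroup E] [Module ℝ E] [TopologicalSpace E]
    (U : Set E) where
  I : Type x
  n : I → ℕ
  p : (i : I) → Fin (n i) → Seminorm ℝ E
  continuous_p : ∀ i j, Continuous (p i j)
  c : (i : I) → Fin (n i) → E
  ε : (i : I) → Fin (n i) → ℝ
  ε_pos : ∀ i j, 0 < ε i j
  eq_iUnion : U = ⋃ i, ⋂ j, {y | p i j (y - c i j) < ε i j}

namespace NonstandardExtension

variable {N : NonstandardExtension.{w}}
variable {E : Type u} [AddCommGroup E] [Module ℝ E] [TopologicalSpace E]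
variable {F : Type v} [AddCommGroup F] [Module ℝ F] [TopologicalSpace F]

/-! ### Maps `f : U → F`

Maps defined on `U ⊆ E` are represented by maps on `E`, of which only the values on `U` matter. -/

/-- The open subset `Û` of `Ê` associated with a presentation of `U`. -/
def hullSet (N : NonstandardExtension.{w}) {U : Set E} (P : BallPresentation.{u, x} U) :
    Set (N.Hull E) :=
  ⋃ i, ⋂ j, {ξ | hullSeminorm (P.p i j) (P.continuous_p i j) (ξ - stdCls (P.c i j)) < P.ε i j}

/-- `int(U*)`: the points of `U*` whose monad is contained in `U*`. -/
def starInterior (N : NonstandardExtension.{w}) (U : Set E) : Set (N.Star E) :=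
  {a | a ∈ N.starSet U ∧ ∀ b, Near b a → b ∈ N.starSet U}

/-- `f` is a finite function on `U`: its extension maps the finite points of `U*` to finite
points. -/
def IsFiniteOn (N : NonstandardExtension.{w}) (f : E → F) (U : Set E) : Prop :=
  ∀ a ∈ N.starSet U, a ∈ N.finitePart E → Star.map f a ∈ N.finitePart F

/-- The value `T(a)(h₁, …, h_j)` at points of `E*` of the extension of a map
`T : U → Lin^j(E, F)`. -/
noncomputable def evalStar {j : ℕ} (T : E → MultilinearMap ℝ (fun _ : Fin j => E) F)
    (a : N.Star E) (h : Fin j → N.Star E) : N.Star F :=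
  Star.map₂ (fun b y => T b y) a (Star.tuple h)

/-- The maps `d j = d^j f : U → Lin^j(E, F)`, `0 ≤ j ≤ k`, with `d^0 f = f`, witness that `f` is
uniformly `C^k` at finite points. -/
structure HasUniformDerivs (N : NonstandardExtension.{w}) (k : ℕ) (f : E → F) (U : Set E)
    (d : (j : ℕ) → E → MultilinearMap ℝ (fun _ : Fin j => E) F) : Prop where
  zero : ∀ a ∈ U, ∀ h : Fin 0 → E, d 0 a h = f a
  /-- `d^{j+1} f(a)` belongs to `FLin^{j+1}(E*, F*)`, i.e. maps finite points to finite points. -/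
  finite : ∀ j < k, ∀ a ∈ N.starInterior U, a ∈ N.finitePart E →
    ∀ h : Fin (j + 1) → N.Star E, (∀ i, h i ∈ N.finitePart E) →
      evalStar (d (j + 1)) a h ∈ N.finitePart F
  succ : ∀ j < k, ∀ a ∈ N.starInterior U, a ∈ N.finitePart E →
    ∀ y ∈ N.finitePart E, ∀ h : Fin j → N.Star E, (∀ i, h i ∈ N.finitePart E) →
      ∀ δ : N.Star ℝ, δ ∈ N.starSet {t | 0 < t} → IsInfinitesimal δ →
        Near (hdiv (evalStar (d j) (a + hsmul δ y) h - evalStar (d j) a h) δ)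
          (evalStar (d (j + 1)) a (Fin.snoc h y))

/-- `f` is uniformly `C^k` at finite points (`k ≥ 1`). -/
def IsUniformlyCk (N : NonstandardExtension.{w}) (k : ℕ) (f : E → F) (U : Set E) : Prop :=
  ∃ d : (j : ℕ) → E → MultilinearMap ℝ (fun _ : Fin j => E) F, N.HasUniformDerivs k f U d

/-- `f` is uniformly smooth at finite points. -/
def IsUniformlySmooth (N : NonstandardExtension.{w}) (f : E → F) (U : Set E) : Prop :=
  ∀ k : ℕ, 1 ≤ k → N.IsUniformlyCk k f U

/-- `g : Û → F̂` is the map induced by `f`: for every `⟦a⟧ ∈ Û` the point `f(a)` is finite and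
`g ⟦a⟧ = ⟦f(a)⟧`. -/
def IsInducedMap (f : E → F) (V : Set (N.Hull E)) (g : N.Hull E → N.Hull F) : Prop :=
  ∀ a : N.finitePart E, cls a ∈ V →
    ∃ hb : Star.map f a.1 ∈ N.finitePart F, g (cls a) = cls ⟨Star.map f a.1, hb⟩

end NonstandardExtension

/-!
The proof rests on three facts about the extended derivatives `d j`, `j ≤ k`, of a map that is
uniformly `C^k` at finite points.

*The derivatives respect `∼`* (`HasUniformDerivs.near_evalStar`). By saturation an infinitesimal
vector is `δ y` with `y` finite and `δ > 0` infinitesimal (`IsSaturated.exists_eq_hsmul`). For a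
change of the directions the claim follows from multilinearity and the finiteness of `d j`. For a
change of the base point from `a` to `a + δ y` and `j < k`, the difference quotient of `d j` is
finite, so the difference is infinitesimal. For `j = k` the difference quotients of `d (k - 1)` at
`a` and at `a + δ y` are compared: since the derivative is uniform over base points in `int(U*)`,
going from `a` to `a + δ (y + z)` directly or via `a + δ y` gives
`d k a (h, y + z) ∼ d k a (h, y) + d k (a + δ y) (h, z)`, and additivity of `d k a` cancels
the terms in `y`. Hence each `d j` induces a map `hullMap (d j)` on `Û × Ê ^ j`.

*The induced maps are continuous, and each is the directional derivative of the one before.*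
Saturation turns statements about all infinitesimal perturbations into `ε`-`r` statements with
standard bounds (`exists_seminorm_lt_of_near`, `exists_pos_lt_of_near`). This gives continuity, and
the derivative from the right; the derivative from the left follows on replacing a direction by its
negative.

*Derivatives are unique*, since `F̂` is Hausdorff, so any system of iterated directional
derivatives of `f̂` consists of the maps `hullMap (d j)`.
-/

namespace NonstandardExtension

variable {N : NonstandardExtension.{w}}

/-! ### Calculus with representatives -/

section Representatives

variable {X : Type*}

theorem Star.exists_rep (a : N.Star X) : ∃ s, ∃ hs : N.Admissible s, a = Star.mk s hs := by
  obtain ⟨s, hs, h⟩ := a.2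
  exact ⟨s, hs, Subtype.ext h.symm⟩

theorem Star.exists_rep_tuple {ι : Type*} (h : ι → N.Star X) :
    ∃ s : ι → N.ι → X, ∃ hs : ∀ l, N.Admissible (s l), h = fun l => Star.mk (s l) (hs l) := by
  choose s hs h' using fun l => (h l).exists_rep
  exact ⟨s, hs, funext h'⟩

theorem Star.mk_eq_mk {s t : N.ι → X} {hs : N.Admissible s} {ht : N.Admissible t} :
    Star.mk s hs = Star.mk t ht ↔ ∀ᶠ i in (N.D : Filter N.ι), s i = t i :=
  Subtype.ext_iff.trans Germ.coe_eq

theorem Star.map_mk {Y : Type*} (g : X → Y) {s : N.ι → X} (hs : N.Admissible s) :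
    Star.map g (Star.mk s hs) = Star.mk _ (hs.comp g) :=
  rfl

theorem mk_mem_starSet {s : N.ι → X} {hs : N.Admissible s} {A : Set X} :
    Star.mk s hs ∈ N.starSet A ↔ ∀ᶠ i in (N.D : Filter N.ι), s i ∈ A :=
  Iff.rfl

end Representatives

section Module

variable {E : Type u} [AddCommGroup E] [Module ℝ E]

theorem Star.mk_add {s t : N.ι → E} (hs : N.Admissible s) (ht : N.Admissible t) :
    Star.mk s hs + Star.mk t ht = Star.mk _ (hs.comp₂ ht (· + ·)) :=
  rfl

theorem Star.mk_sub {s t : N.ι → E} (hs : N.Admissible s) (ht : N.Admissible t) :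
    Star.mk s hs - Star.mk t ht = Star.mk _ (hs.comp₂ ht (· - ·)) :=
  rfl

theorem Star.smul_mk (c : ℝ) {s : N.ι → E} (hs : N.Admissible s) :
    c • Star.mk s hs = Star.mk _ (hs.comp (c • ·)) :=
  rfl

theorem hsmul_mk {δ : N.ι → ℝ} {s : N.ι → E} (hδ : N.Admissible δ) (hs : N.Admissible s) :
    hsmul (Star.mk δ hδ) (Star.mk s hs) = Star.mk _ (hδ.comp₂ hs fun t z => t • z) :=
  rfl

theorem hdiv_mk {δ : N.ι → ℝ} {s : N.ι → E} (hδ : N.Admissible δ) (hs : N.Admissible s) :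
    hdiv (Star.mk s hs) (Star.mk δ hδ) = Star.mk _ (hδ.comp₂ hs fun t z => t⁻¹ • z) :=
  rfl

theorem hdiv_add (y z : N.Star E) (δ : N.Star ℝ) : hdiv (y + z) δ = hdiv y δ + hdiv z δ := by
  obtain ⟨s, hs, rfl⟩ := y.exists_rep
  obtain ⟨t, ht, rfl⟩ := z.exists_rep
  obtain ⟨e, he, rfl⟩ := δ.exists_rep
  simp only [Star.mk_add, hdiv_mk]
  exact Star.mk_eq_mk.2 (.of_forall fun i => smul_add _ _ _)

theorem hsmul_add (y z : N.Star E) (δ : N.Star ℝ) : hsmul δ (y + z) = hsmul δ y + hsmul δ z := by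
  obtain ⟨s, hs, rfl⟩ := y.exists_rep
  obtain ⟨t, ht, rfl⟩ := z.exists_rep
  obtain ⟨e, he, rfl⟩ := δ.exists_rep
  simp only [Star.mk_add, hsmul_mk]
  exact Star.mk_eq_mk.2 (.of_forall fun i => smul_add _ _ _)

theorem hsmul_hdiv {δ : N.Star ℝ} (hδ : δ ∈ N.starSet {t | 0 < t}) (y : N.Star E) :
    hsmul δ (hdiv y δ) = y := by
  obtain ⟨s, hs, rfl⟩ := y.exists_rep
  obtain ⟨e, he, rfl⟩ := δ.exists_rep
  rw [hdiv_mk, hsmul_mk, Star.mk_eq_mk]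
  filter_upwards [mk_mem_starSet.1 hδ] with i hi
  exact smul_inv_smul₀ (ne_of_gt hi) _

variable [TopologicalSpace E]

theorem mk_mem_finitePart {s : N.ι → E} {hs : N.Admissible s} :
    Star.mk s hs ∈ N.finitePart E ↔ ∀ p : Seminorm ℝ E, Continuous p →
      ∃ r : ℝ, ∀ᶠ i in (N.D : Filter N.ι), p (s i) ≤ r := by
  refine forall₂_congr fun p _ => exists_congr fun r => eventually_congr (.of_forall fun i => ?_)
  simp [abs_of_nonneg (apply_nonneg p _)]

theorem mk_mem_monad {s : N.ι → E} {hs : N.Admissible s} :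
    Star.mk s hs ∈ N.monad E ↔ ∀ p : Seminorm ℝ E, Continuous p →
      ∀ r : ℝ, 0 < r → ∀ᶠ i in (N.D : Filter N.ι), p (s i) < r := by
  refine forall₂_congr fun p _ => forall₂_congr fun r _ => eventually_congr (.of_forall fun i => ?_)
  simp [abs_of_nonneg (apply_nonneg p _)]

theorem near_mk {s t : N.ι → E} {hs : N.Admissible s} {ht : N.Admissible t} :
    Near (Star.mk s hs) (Star.mk t ht) ↔ ∀ p : Seminorm ℝ E, Continuous p →
      ∀ r : ℝ, 0 < r → ∀ᶠ i in (N.D : Filter N.ι), p (s i - t i) < r := by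
  rw [Near, Star.mk_sub, mk_mem_monad]

theorem mem_finitePart_of_mem_monad {y : N.Star E} (hy : y ∈ N.monad E) : y ∈ N.finitePart E :=
  fun p hp => (hy p hp).isLimited

theorem hsmul_mem_monad {δ : N.Star ℝ} (hδ : IsInfinitesimal δ) {y : N.Star E}
    (hy : y ∈ N.finitePart E) : hsmul δ y ∈ N.monad E := by
  obtain ⟨s, hs, rfl⟩ := y.exists_rep
  obtain ⟨e, he, rfl⟩ := δ.exists_rep
  rw [hsmul_mk, mk_mem_monad]
  intro p hp r hr
  obtain ⟨R, hR⟩ := mk_mem_finitePart.1 hy p hp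
  have hR' : 0 < |R| + 1 := by positivity
  filter_upwards [hR, mk_mem_starSet.1 (hδ (r / (|R| + 1)) (by positivity))] with i h1 h2
  rw [map_smul_eq_mul, Real.norm_eq_abs]
  have h3 : p (s i) ≤ |R| + 1 := by linarith [le_abs_self R]
  have h4 : |e i| * (|R| + 1) < r := (lt_div_iff₀ hR').1 h2
  exact (mul_le_mul_of_nonneg_left h3 (abs_nonneg _)).trans_lt h4

theorem Near.refl (a : N.Star E) : Near a a := by
  simp [Near]

theorem Near.symm {a b : N.Star E} (h : Near a b) : Near b a := by
  simpa [Near] using (N.monad E).neg_mem h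

theorem Near.trans {a b c : N.Star E} (h : Near a b) (h' : Near b c) : Near a c := by
  simpa [Near] using (N.monad E).add_mem h h'

theorem Near.add {a b a' b' : N.Star E} (h : Near a b) (h' : Near a' b') :
    Near (a + a') (b + b') := by
  have := (N.monad E).add_mem h h'
  rwa [sub_add_sub_comm] at this

theorem Near.mem_finitePart {a b : N.Star E} (h : Near a b) (hb : b ∈ N.finitePart E) :
    a ∈ N.finitePart E := by
  simpa using (N.finitePart E).add_mem (mem_finitePart_of_mem_monad h) hb

theorem Near.mem_starInterior {U : Set E} {a b : N.Star E} (h : Near b a)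
    (ha : a ∈ N.starInterior U) : b ∈ N.starInterior U :=
  ⟨ha.2 b h, fun _ hc => ha.2 _ (hc.trans h)⟩

end Module

/-! ### Extensions of multilinear maps -/

section EvalStar

variable {E : Type u} [AddCommGroup E] [Module ℝ E]
variable {F : Type v} [AddCommGroup F] [Module ℝ F]

theorem evalStar_mk {j : ℕ} (T : E → MultilinearMap ℝ (fun _ : Fin j => E) F) {s : N.ι → E}
    (hs : N.Admissible s) (t : Fin j → N.ι → E) (ht : ∀ l, N.Admissible (t l)) :
    evalStar T (Star.mk s hs) (fun l => Star.mk (t l) (ht l)) =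
      Star.mk (fun i => T (s i) fun l => t l i)
        (hs.comp₂ (Admissible.pi ht) fun b y => T b y) := by
  rw [evalStar, Star.tuple_mk]
  rfl

theorem update_mk {X : Type*} {j : ℕ} (t : Fin j → N.ι → X) (ht : ∀ l, N.Admissible (t l))
    (l : Fin j) {z : N.ι → X} (hz : N.Admissible z) :
    Function.update (fun l => Star.mk (t l) (ht l)) l (Star.mk z hz) =
      fun m => Star.mk (Function.update t l z m)
        (Function.forall_update_iff t (fun _ s => N.Admissible s) |>.2
          ⟨hz, fun m _ => ht m⟩ m) := by
  funext m
  rcases eq_or_ne m l with rfl | h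
  · simp
  · simp [h]

theorem update_apply {X Y : Type*} {j : ℕ} (t : Fin j → Y → X) (l : Fin j) (z : Y → X) (i : Y) :
    (fun m => Function.update t l z m i) = Function.update (fun m => t m i) l (z i) := by
  funext m
  rcases eq_or_ne m l with rfl | h
  · simp
  · simp [h]

variable {j : ℕ} (T : E → MultilinearMap ℝ (fun _ : Fin j => E) F)

theorem evalStar_update_add (a : N.Star E) (h : Fin j → N.Star E) (l : Fin j) (y z : N.Star E) :
    evalStar T a (Function.update h l (y + z)) =
      evalStar T a (Function.update h l y) + evalStar T a (Function.update h l z) := by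
  obtain ⟨s, hs, rfl⟩ := a.exists_rep
  obtain ⟨t, ht, rfl⟩ := Star.exists_rep_tuple h
  obtain ⟨y, hy, rfl⟩ := y.exists_rep
  obtain ⟨z, hz, rfl⟩ := z.exists_rep
  simp only [Star.mk_add, update_mk, evalStar_mk]
  exact Star.mk_eq_mk.2 (.of_forall fun i => by
    simp only [update_apply, MultilinearMap.map_update_add])

theorem evalStar_update_hsmul (a : N.Star E) (h : Fin j → N.Star E) (l : Fin j) (δ : N.Star ℝ)
    (y : N.Star E) :
    evalStar T a (Function.update h l (hsmul δ y)) =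
      hsmul δ (evalStar T a (Function.update h l y)) := by
  obtain ⟨s, hs, rfl⟩ := a.exists_rep
  obtain ⟨t, ht, rfl⟩ := Star.exists_rep_tuple h
  obtain ⟨y, hy, rfl⟩ := y.exists_rep
  obtain ⟨e, he, rfl⟩ := δ.exists_rep
  simp only [hsmul_mk, update_mk, evalStar_mk]
  exact Star.mk_eq_mk.2 (.of_forall fun i => by
    simp only [update_apply, MultilinearMap.map_update_smul])

theorem evalStar_update_sub (a : N.Star E) (h : Fin j → N.Star E) (l : Fin j) (y z : N.Star E) :
    evalStar T a (Function.update h l (y - z)) =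
      evalStar T a (Function.update h l y) - evalStar T a (Function.update h l z) := by
  rw [eq_sub_iff_add_eq, ← evalStar_update_add, sub_add_cancel]

theorem evalStar_snoc_add (T : E → MultilinearMap ℝ (fun _ : Fin (j + 1) => E) F) (a : N.Star E)
    (h : Fin j → N.Star E) (y z : N.Star E) :
    evalStar T a (Fin.snoc h (y + z)) =
      evalStar T a (Fin.snoc h y) + evalStar T a (Fin.snoc h z) := by
  simpa only [Fin.update_snoc_last] using
    evalStar_update_add T a (Fin.snoc h y) (Fin.last j) y z

theorem evalStar_snoc_neg (T : E → MultilinearMap ℝ (fun _ : Fin (j + 1) => E) F) (a : N.Star E)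
    (h : Fin j → N.Star E) (y : N.Star E) :
    evalStar T a (Fin.snoc h (-y)) = -evalStar T a (Fin.snoc h y) := by
  have h0 := evalStar_snoc_add T a h 0 0
  rw [add_zero, left_eq_add] at h0
  rw [eq_neg_iff_add_eq_zero, ← evalStar_snoc_add, neg_add_cancel, h0]

theorem evalStar_zero (T : E → MultilinearMap ℝ (fun _ : Fin 0 => E) F) {f : E → F} {U : Set E}
    (hT : ∀ a ∈ U, ∀ h : Fin 0 → E, T a h = f a) {a : N.Star E} (ha : a ∈ N.starSet U)
    (h : Fin 0 → N.Star E) : evalStar T a h = Star.map f a := by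
  obtain ⟨s, hs, rfl⟩ := a.exists_rep
  obtain ⟨t, ht, rfl⟩ := Star.exists_rep_tuple h
  rw [evalStar_mk, Star.map_mk, Star.mk_eq_mk]
  filter_upwards [mk_mem_starSet.1 ha] with i hi using hT _ hi _

end EvalStar

/-! ### Saturation -/

section Saturation

variable {E : Type u} [AddCommGroup E] [Module ℝ E] [TopologicalSpace E]

/-- Saturation for a family of internal sets that decreases along the continuous seminorms on `E`
and along the natural numbers. Each set is given by an admissible function `A p n` on the index set,
and the common point `x` is an admissible representative. -/
theorem IsSaturated.exists_forall_mem {κ : Cardinal.{u}} (hκ : ℵ₀ < κ)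
    (hE : #{p : Seminorm ℝ E // Continuous p} < κ) (hN : N.IsSaturated κ) {X : Type u}
    (A : {p : Seminorm ℝ E // Continuous p} → ℕ → N.ι → Set X)
    (hA : ∀ p n, N.Admissible (A p n))
    (hanti : ∀ p p' n n', p ≤ p' → n ≤ n' → ∀ i, A p' n' i ⊆ A p n i)
    (hne : ∀ p n, ∀ᶠ i in (N.D : Filter N.ι), (A p n i).Nonempty) :
    ∃ x : N.ι → X, N.Admissible x ∧ ∀ p n, ∀ᶠ i in (N.D : Filter N.ι), x i ∈ A p n i := by
  classical
  let J := {p : Seminorm ℝ E // Continuous p} × ULift.{u} ℕ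
  have hJ : #J < κ := by
    rw [Cardinal.mk_prod]
    exact Cardinal.mul_lt_of_lt hκ.le (by simpa using hE) (by simpa using hκ)
  obtain ⟨x, hx⟩ := hN X J (fun q => Star.mk (A q.1 q.2.down) (hA _ _)) hJ fun S => by
    -- Finitely many members of the family all contain the member at a common upper bound.
    have hbd : ∃ p n, ∀ q ∈ S, q.1 ≤ p ∧ q.2.down ≤ n := by
      refine S.induction_on ⟨⟨0, continuous_zero⟩, 0, by simp⟩ ?_
      rintro ⟨⟨p, hp⟩, ⟨n⟩⟩ S _ ⟨⟨p', hp'⟩, n', h⟩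
      refine ⟨⟨p ⊔ p', hp.sup hp'⟩, n ⊔ n', fun q hq => ?_⟩
      rcases Finset.mem_insert.1 hq with rfl | hq
      · exact ⟨le_sup_left (a := p), le_sup_left⟩
      · exact ⟨(h q hq).1.trans (le_sup_right (a := p)), (h q hq).2.trans le_sup_right⟩
    obtain ⟨p, n, h⟩ := hbd
    obtain ⟨i, x₀, -⟩ := (hne p n).exists
    -- A choice function on `Set X` makes the chosen points admissible.
    have hg : ∀ B : Set X, ∃ x, B.Nonempty → x ∈ B := fun B => by
      by_cases hB : B.Nonempty
      · exact ⟨hB.some, fun _ => hB.some_mem⟩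
      · exact ⟨x₀, fun h => absurd h hB⟩
    choose g hg using hg
    refine ⟨Star.mk _ ((hA p n).comp g), Set.mem_iInter₂.2 fun q hq => ?_⟩
    change ∀ᶠ i in (N.D : Filter N.ι), g (A p n i) ∈ A q.1 q.2.down i
    filter_upwards [hne p n] with i hi
    exact hanti _ _ _ _ (h q hq).1 (h q hq).2 i (hg _ hi)
  obtain ⟨s, hs, rfl⟩ := x.exists_rep
  exact ⟨s, hs, fun p n => Set.mem_iInter.1 hx (p, ⟨n⟩)⟩

/-- Every infinitesimal vector is an infinitesimal multiple of a finite one: by saturation some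
infinitesimal `δ > 0` dominates `p y` for all continuous seminorms `p`, and `y / δ` is finite. -/
theorem IsSaturated.exists_eq_hsmul {κ : Cardinal.{u}} (hκ : ℵ₀ < κ)
    (hE : #{p : Seminorm ℝ E // Continuous p} < κ) (hN : N.IsSaturated κ) {y : N.Star E}
    (hy : y ∈ N.monad E) :
    ∃ δ : N.Star ℝ, δ ∈ N.starSet {t | 0 < t} ∧ IsInfinitesimal δ ∧
      ∃ z ∈ N.finitePart E, y = hsmul δ z := by
  obtain ⟨s, hs, rfl⟩ := y.exists_rep
  rw [mk_mem_monad] at hy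
  obtain ⟨e, he, h⟩ := hN.exists_forall_mem hκ hE (X := ULift.{u} ℝ)
    (fun p n i => {t : ULift.{u} ℝ | 0 < t.down ∧ t.down < 1 / ((n : ℝ) + 1) ∧ p.1 (s i) ≤ t.down})
    (fun p n => hs.comp fun z =>
      {t : ULift.{u} ℝ | 0 < t.down ∧ t.down < 1 / ((n : ℝ) + 1) ∧ p.1 z ≤ t.down})
    (fun p p' n n' hp hn i (t : ULift.{u} ℝ) ht =>
      ⟨ht.1, ht.2.1.trans_le (Nat.one_div_le_one_div hn), (hp _).trans ht.2.2⟩)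
    (fun p n => by
      have hn : 0 < 1 / ((n : ℝ) + 1) := Nat.one_div_pos_of_nat
      -- The midpoint of `p (s i)` and `1 / (n + 1)` is positive even where `p (s i)` vanishes.
      filter_upwards [hy p.1 p.2 _ hn] with i hi
      have := apply_nonneg p.1 (s i)
      exact ⟨⟨(p.1 (s i) + 1 / ((n : ℝ) + 1)) / 2⟩, by dsimp only; linarith,
        by dsimp only; linarith, by dsimp only; linarith⟩)
  have hpos : ∀ᶠ i in (N.D : Filter N.ι), 0 < (e i).down := (h ⟨0, continuous_zero⟩ 0).mono
    fun i hi => hi.1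
  have he' : N.Admissible fun i => (e i).down := he.comp ULift.down
  refine ⟨Star.mk _ he', hpos, fun r hr => ?_, Star.mk _ (he'.comp₂ hs fun t z => t⁻¹ • z), ?_, ?_⟩
  · obtain ⟨n, hn⟩ := exists_nat_one_div_lt hr
    refine mk_mem_starSet.2 ((h ⟨0, continuous_zero⟩ n).mono fun i hi => ?_)
    exact (abs_of_pos hi.1).trans_lt (hi.2.1.trans hn)
  · refine mk_mem_finitePart.2 fun p hp => ⟨1, (h ⟨p, hp⟩ 0).mono fun i hi => ?_⟩
    rw [map_smul_eq_mul, norm_inv, Real.norm_of_nonneg hi.1.le]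
    exact inv_mul_le_one_of_le₀ hi.2.2 hi.1.le
  · exact (hsmul_hdiv (δ := Star.mk _ he') hpos (Star.mk s hs)).symm

end Saturation

variable {E : Type u} [AddCommGroup E] [Module ℝ E] [TopologicalSpace E]
variable {F : Type v} [AddCommGroup F] [Module ℝ F] [TopologicalSpace F]

/-! ### The derivatives respect infinite closeness -/

section Near

variable {κ : Cardinal.{u}} {k : ℕ} {f : E → F} {U : Set E}
  {d : (j : ℕ) → E → MultilinearMap ℝ (fun _ : Fin j => E) F}

theorem HasUniformDerivs.evalStar_mem_finitePart (hf : N.IsFiniteOn f U)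
    (hd : N.HasUniformDerivs k f U d) {j : ℕ} (hj : j ≤ k) {a : N.Star E}
    (ha : a ∈ N.starInterior U) (ha' : a ∈ N.finitePart E) {h : Fin j → N.Star E}
    (hh : ∀ l, h l ∈ N.finitePart E) : evalStar (d j) a h ∈ N.finitePart F := by
  cases j with
  | zero =>
    rw [evalStar_zero (d 0) hd.zero ha.1]
    exact hf a ha.1 ha'
  | succ j => exact hd.finite j hj a ha ha' h hh

theorem HasUniformDerivs.near_of_lt (hκ : ℵ₀ < κ) (hE : #{p : Seminorm ℝ E // Continuous p} < κ)
    (hN : N.IsSaturated κ) (hd : N.HasUniformDerivs k f U d) {j : ℕ} (hj : j < k) {a b : N.Star E}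
    (ha : a ∈ N.starInterior U) (ha' : a ∈ N.finitePart E) (hb : Near b a) {h : Fin j → N.Star E}
    (hh : ∀ l, h l ∈ N.finitePart E) : Near (evalStar (d j) b h) (evalStar (d j) a h) := by
  obtain ⟨δ, hδ, hδ', y, hy, hby⟩ := hN.exists_eq_hsmul hκ hE hb
  obtain rfl : b = a + hsmul δ y := by rw [← hby]; abel
  have hfin : evalStar (d (j + 1)) a (Fin.snoc h y) ∈ N.finitePart F :=
    hd.finite j hj a ha ha' _ fun l => by refine Fin.lastCases ?_ (fun m => ?_) l <;> simp [hy, hh]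
  have := hsmul_mem_monad hδ' ((hd.succ j hj a ha ha' y hy h hh δ hδ hδ').mem_finitePart hfin)
  rwa [hsmul_hdiv hδ] at this

/-- The top derivative is not differentiable, so its values at infinitely close points `a` and
`b = a + δ y` are compared through the difference quotients of the derivative below it: those at `a`
in the directions `y + z` and `y` differ, up to an infinitesimal, by the one at `b` in the
direction `z`. -/
theorem HasUniformDerivs.near_snoc (hκ : ℵ₀ < κ) (hE : #{p : Seminorm ℝ E // Continuous p} < κ)
    (hN : N.IsSaturated κ) (hd : N.HasUniformDerivs k f U d) {j : ℕ} (hj : j < k) {a b : N.Star E}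
    (ha : a ∈ N.starInterior U) (ha' : a ∈ N.finitePart E) (hb : Near b a) {h : Fin j → N.Star E}
    (hh : ∀ l, h l ∈ N.finitePart E) {z : N.Star E} (hz : z ∈ N.finitePart E) :
    Near (evalStar (d (j + 1)) b (Fin.snoc h z)) (evalStar (d (j + 1)) a (Fin.snoc h z)) := by
  have hb' := hb.mem_starInterior ha
  have hb'' := hb.mem_finitePart ha'
  obtain ⟨δ, hδ, hδ', y, hy, hby⟩ := hN.exists_eq_hsmul hκ hE hb
  obtain rfl : b = a + hsmul δ y := by rw [← hby]; abel
  have h1 := hd.succ j hj a ha ha' (y + z) ((N.finitePart E).add_mem hy hz) h hh δ hδ hδ'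
  have h2 := hd.succ j hj a ha ha' y hy h hh δ hδ hδ'
  have h3 := hd.succ j hj _ hb' hb'' z hz h hh δ hδ hδ'
  rw [hsmul_add, ← add_assoc, evalStar_snoc_add] at h1
  have h4 := h3.add h2
  rw [← hdiv_add, sub_add_sub_cancel] at h4
  have h5 := h4.symm.trans h1
  rwa [Near, add_comm (evalStar (d (j + 1)) a (Fin.snoc h y)), add_sub_add_right_eq_sub] at h5

theorem near_evalStar_update (hκ : ℵ₀ < κ) (hE : #{p : Seminorm ℝ E // Continuous p} < κ)
    (hN : N.IsSaturated κ) {j : ℕ} {T : E → MultilinearMap ℝ (fun _ : Fin j => E) F}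
    {a : N.Star E} (hT : ∀ h : Fin j → N.Star E, (∀ l, h l ∈ N.finitePart E) →
      evalStar T a h ∈ N.finitePart F) {h : Fin j → N.Star E} (hh : ∀ l, h l ∈ N.finitePart E)
    (l : Fin j) {y z : N.Star E} (hyz : Near y z) :
    Near (evalStar T a (Function.update h l y)) (evalStar T a (Function.update h l z)) := by
  obtain ⟨δ, -, hδ, v, hv, hyz⟩ := hN.exists_eq_hsmul hκ hE hyz
  rw [Near, ← evalStar_update_sub, hyz, evalStar_update_hsmul]
  refine hsmul_mem_monad hδ (hT _ fun m => ?_)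
  rcases eq_or_ne m l with rfl | hm
  · simpa using hv
  · simpa [hm] using hh m

theorem near_evalStar_of_near (hκ : ℵ₀ < κ) (hE : #{p : Seminorm ℝ E // Continuous p} < κ)
    (hN : N.IsSaturated κ) {j : ℕ} {T : E → MultilinearMap ℝ (fun _ : Fin j => E) F}
    {a : N.Star E} (hT : ∀ h : Fin j → N.Star E, (∀ l, h l ∈ N.finitePart E) →
      evalStar T a h ∈ N.finitePart F) {h h' : Fin j → N.Star E}
    (hh : ∀ l, h l ∈ N.finitePart E) (hh' : ∀ l, Near (h' l) (h l)) :
    Near (evalStar T a h') (evalStar T a h) := by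
  classical
  -- The arguments are replaced one at a time.
  suffices H : ∀ s : Finset (Fin j), Near (evalStar T a (s.piecewise h' h)) (evalStar T a h) by
    simpa using H Finset.univ
  intro s
  induction s using Finset.induction_on with
  | empty => simpa using Near.refl _
  | insert l s hl ih =>
    refine Near.trans ?_ ih
    have hfin : ∀ m, s.piecewise h' h m ∈ N.finitePart E := fun m => by
      by_cases hm : m ∈ s
      · simpa [hm] using (hh' m).mem_finitePart (hh m)
      · simpa [hm] using hh m
    have := near_evalStar_update hκ hE hN hT hfin l (y := h' l)
      (z := s.piecewise h' h l) (by simpa [hl] using hh' l)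
    rwa [Function.update_eq_self, ← Finset.piecewise_insert] at this

theorem HasUniformDerivs.near_evalStar (hκ : ℵ₀ < κ)
    (hE : #{p : Seminorm ℝ E // Continuous p} < κ) (hN : N.IsSaturated κ) (hf : N.IsFiniteOn f U)
    (hk : 1 ≤ k) (hd : N.HasUniformDerivs k f U d) {j : ℕ} (hj : j ≤ k) {a b : N.Star E}
    (ha : a ∈ N.starInterior U) (ha' : a ∈ N.finitePart E) (hb : Near b a)
    {h h' : Fin j → N.Star E} (hh : ∀ l, h l ∈ N.finitePart E) (hh' : ∀ l, Near (h' l) (h l)) :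
    Near (evalStar (d j) b h') (evalStar (d j) a h) := by
  refine (near_evalStar_of_near hκ hE hN (fun g hg => hd.evalStar_mem_finitePart hf hj
    (hb.mem_starInterior ha) (hb.mem_finitePart ha') hg) hh hh').trans ?_
  cases j with
  | zero => exact hd.near_of_lt hκ hE hN hk ha ha' hb hh
  | succ j =>
    rw [← Fin.snoc_init_self h]
    exact hd.near_snoc hκ hE hN hj ha ha' hb (fun l => hh l.castSucc) (hh (Fin.last j))

end Near

/-! ### From infinitesimal to standard neighbourhoods -/

section Overspill

variable {κ : Cardinal.{u}}

/-- A map that takes infinitely close arguments to infinitely close values is continuous with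
standard `ε` and `r`: otherwise saturation, applied to the internal sets of counterexamples in
balls `p < 1 / (n + 1)`, produces a counterexample infinitely close to the given point. -/
theorem exists_seminorm_lt_of_near (hκ : ℵ₀ < κ) (hE : #{p : Seminorm ℝ E // Continuous p} < κ)
    (hN : N.IsSaturated κ) {j : ℕ} {T : E → MultilinearMap ℝ (fun _ : Fin j => E) F}
    {a : N.Star E} {h : Fin j → N.Star E}
    (hT : ∀ b h', Near b a → (∀ l, Near (h' l) (h l)) → Near (evalStar T b h') (evalStar T a h))
    {q : Seminorm ℝ F} (hq : Continuous q) {ε : ℝ} (hε : 0 < ε) :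
    ∃ p : Seminorm ℝ E, Continuous p ∧ ∃ r : ℝ, 0 < r ∧ ∀ b h',
      Star.map p (b - a) ∈ N.starSet (Set.Iio r) →
      (∀ l, Star.map p (h' l - h l) ∈ N.starSet (Set.Iio r)) →
      Star.map q (evalStar T b h' - evalStar T a h) ∈ N.starSet (Set.Iio ε) := by
  by_contra! H
  obtain ⟨s, hs, rfl⟩ := a.exists_rep
  obtain ⟨t, ht, rfl⟩ := Star.exists_rep_tuple h
  let B (p : {p : Seminorm ℝ E // Continuous p}) (n : ℕ) (a : E) (h : Fin j → E) :
      Set (E × (Fin j → E)) :=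
    {x | p.1 (x.1 - a) < 1 / ((n : ℝ) + 1) ∧ (∀ l, p.1 (x.2 l - h l) < 1 / ((n : ℝ) + 1)) ∧
      ε ≤ q (T x.1 x.2 - T a h)}
  obtain ⟨x, hx, hxB⟩ := hN.exists_forall_mem hκ hE (fun p n i => B p n (s i) fun l => t l i)
    (fun p n => hs.comp₂ (Admissible.pi ht) (B p n))
    (fun p p' n n' hp hn i x hx => by
      have := Nat.one_div_le_one_div (α := ℝ) hn
      exact ⟨(hp _).trans_lt (hx.1.trans_le this),
        fun l => (hp _).trans_lt ((hx.2.1 l).trans_le this), hx.2.2⟩)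
    (fun p n => by
      obtain ⟨b, h', h1, h2, h3⟩ := H p.1 p.2 _ (Nat.one_div_pos_of_nat (n := n))
      obtain ⟨b, hb, rfl⟩ := b.exists_rep
      obtain ⟨h', hh', rfl⟩ := Star.exists_rep_tuple h'
      simp only [Star.mk_sub, Star.map_mk, evalStar_mk, mk_mem_starSet] at h1 h2 h3
      filter_upwards [h1, eventually_all.2 h2, Ultrafilter.eventually_not.2 h3] with i h1 h2 h3
      exact ⟨(b i, fun l => h' l i), h1, h2, not_lt.1 h3⟩)
  have hx2 : ∀ l, N.Admissible fun i => (x i).2 l := fun l => hx.comp fun x => x.2 l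
  have hbig : ∀ {p : Seminorm ℝ E} (hp : Continuous p) {r : ℝ}, 0 < r →
      ∃ n : ℕ, 1 / ((n : ℝ) + 1) < r ∧ ∀ᶠ i in (N.D : Filter N.ι),
        x i ∈ B ⟨p, hp⟩ n (s i) fun l => t l i := fun hp r hr =>
    (exists_nat_one_div_lt hr).imp fun n hn => ⟨hn, hxB ⟨_, hp⟩ n⟩
  have key := hT (Star.mk _ (hx.comp Prod.fst)) (fun l => Star.mk _ (hx2 l))
    (near_mk.2 fun p hp r hr => by
      obtain ⟨n, hn, hB⟩ := hbig hp hr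
      exact hB.mono fun i hi => hi.1.trans hn)
    (fun l => near_mk.2 fun p hp r hr => by
      obtain ⟨n, hn, hB⟩ := hbig hp hr
      exact hB.mono fun i hi => (hi.2.1 l).trans hn)
  rw [evalStar_mk, evalStar_mk, near_mk] at key
  obtain ⟨i, h1, h2⟩ := ((key q hq ε hε).and (hxB ⟨0, continuous_zero⟩ 0)).exists
  exact absurd h1 (not_lt.2 h2.2.2)

/-- A difference quotient that is infinitely close to `z` for every positive infinitesimal
increment is within any standard `ε` of `z` for all small standard increments. -/
theorem exists_pos_lt_of_near (hκ : ℵ₀ < κ) (hE : #{p : Seminorm ℝ E // Continuous p} < κ)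
    (hN : N.IsSaturated κ) {j : ℕ} {T : E → MultilinearMap ℝ (fun _ : Fin j => E) F}
    {a y : N.Star E} {h : Fin j → N.Star E} {z : N.Star F}
    (hT : ∀ δ : N.Star ℝ, δ ∈ N.starSet {t | 0 < t} → IsInfinitesimal δ →
      Near (hdiv (evalStar T (a + hsmul δ y) h - evalStar T a h) δ) z)
    {q : Seminorm ℝ F} (hq : Continuous q) {ε : ℝ} (hε : 0 < ε) :
    ∃ r : ℝ, 0 < r ∧ ∀ t : ℝ, 0 < t → t < r →
      Star.map q (t⁻¹ • (evalStar T (a + t • y) h - evalStar T a h) - z) ∈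
        N.starSet (Set.Iio ε) := by
  by_contra! H
  obtain ⟨s, hs, rfl⟩ := a.exists_rep
  obtain ⟨t, ht, rfl⟩ := Star.exists_rep_tuple h
  obtain ⟨y, hy, rfl⟩ := y.exists_rep
  obtain ⟨z, hz, rfl⟩ := z.exists_rep
  let Q (i : N.ι) (e : ℝ) : F :=
    e⁻¹ • (T (s i + e • y i) (fun l => t l i) - T (s i) fun l => t l i) - z i
  have hQ : N.Admissible Q :=
    ((hs.comp₂ hy Prod.mk).comp₂ ((Admissible.pi ht).comp₂ hz Prod.mk) Prod.mk).comp
      fun (x : (E × E) × (Fin j → E) × F) (e : ℝ) =>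
        e⁻¹ • (T (x.1.1 + e • x.1.2) x.2.1 - T x.1.1 x.2.1) - x.2.2
  obtain ⟨e, he, h⟩ := hN.exists_forall_mem hκ hE (X := ULift.{u} ℝ)
    (fun p n i => {e | 0 < e.down ∧ e.down < 1 / ((n : ℝ) + 1) ∧ ε ≤ q (Q i e.down)})
    (fun p n => hQ.comp fun g =>
      {e : ULift.{u} ℝ | 0 < e.down ∧ e.down < 1 / ((n : ℝ) + 1) ∧ ε ≤ q (g e.down)})
    (fun p p' n n' hp hn i (e : ULift.{u} ℝ) he =>
      ⟨he.1, he.2.1.trans_le (Nat.one_div_le_one_div hn), he.2.2⟩)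
    (fun p n => by
      obtain ⟨e, h1, h2, h3⟩ := H _ (Nat.one_div_pos_of_nat (n := n))
      simp only [Star.mk_add, Star.smul_mk, Star.mk_sub, Star.map_mk, evalStar_mk,
        mk_mem_starSet] at h3
      filter_upwards [Ultrafilter.eventually_not.2 h3] with i h3
      exact ⟨⟨e⟩, h1, h2, not_lt.1 h3⟩)
  have he' : N.Admissible fun i => (e i).down := he.comp ULift.down
  have key := hT (Star.mk _ he') ((h ⟨0, continuous_zero⟩ 0).mono fun i hi => hi.1)
    (fun r hr => by
      obtain ⟨n, hn⟩ := exists_nat_one_div_lt hr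
      refine mk_mem_starSet.2 ((h ⟨0, continuous_zero⟩ n).mono fun i hi => ?_)
      exact (abs_of_pos hi.1).trans_lt (hi.2.1.trans hn))
  simp only [hsmul_mk, Star.mk_add, evalStar_mk, Star.mk_sub, hdiv_mk, near_mk] at key
  obtain ⟨i, h1, h2⟩ := ((key q hq ε hε).and (h ⟨0, continuous_zero⟩ 0)).exists
  exact absurd h1 (not_lt.2 h2.2.2)

end Overspill

/-! ### The nonstandard hull -/

section Hull

theorem cls_surjective : Function.Surjective (cls : N.finitePart E → N.Hull E) :=
  Submodule.Quotient.mk_surjective _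

theorem cls_eq_cls {a b : N.finitePart E} : cls a = cls b ↔ Near a.1 b.1 :=
  Submodule.Quotient.eq _

theorem cls_add (a b : N.finitePart E) : cls (a + b) = cls a + cls b :=
  rfl

theorem cls_sub (a b : N.finitePart E) : cls (a - b) = cls a - cls b :=
  rfl

theorem cls_neg (a : N.finitePart E) : cls (-a) = -cls a :=
  rfl

theorem cls_smul (c : ℝ) (a : N.finitePart E) : cls (c • a) = c • cls a :=
  rfl

theorem eventually_lt_of_hullSeminorm_lt {p : Seminorm ℝ E} (hp : Continuous p)
    {a : N.finitePart E} {r : ℝ} (h : hullSeminorm p hp (cls a) < r) :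
    Star.map p a.1 ∈ N.starSet (Set.Iio r) := by
  rw [hullSeminorm_cls] at h
  have h1 := st_spec (a.2 p hp) (sub_pos.2 h)
  obtain ⟨s, hs, hs'⟩ := (Star.map p a.1).exists_rep
  rw [hs'] at h1 ⊢
  filter_upwards [mk_mem_starSet.1 h1] with i hi
  change s i < r
  have := (abs_lt.1 hi).2
  linarith

theorem hullSeminorm_le_of_eventually_lt {p : Seminorm ℝ E} (hp : Continuous p)
    {a : N.finitePart E} {r : ℝ} (h : Star.map p a.1 ∈ N.starSet (Set.Iio r)) :
    hullSeminorm p hp (cls a) ≤ r := by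
  rw [hullSeminorm_cls]
  refine le_of_forall_pos_le_add fun ε hε => ?_
  have h1 := st_spec (a.2 p hp) hε
  obtain ⟨s, hs, hs'⟩ := (Star.map p a.1).exists_rep
  rw [hs'] at h h1 ⊢
  obtain ⟨i, hi, hi'⟩ := ((mk_mem_starSet.1 h1).and (mk_mem_starSet.1 h)).exists
  have h2 := (abs_lt.1 (Set.mem_ofPred.1 hi)).1
  have h3 : s i < r := hi'
  linarith

theorem withSeminorms_hull : WithSeminorms (𝕜 := ℝ)
    (fun p : {p : Seminorm ℝ E // Continuous p} => hullSeminorm (N := N) p.1 p.2) :=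
  ⟨rfl⟩

instance : IsTopologicalAddGroup (N.Hull E) :=
  withSeminorms_hull.topologicalAddGroup

instance : ContinuousSMul ℝ (N.Hull E) :=
  withSeminorms_hull.continuousSMul

instance : T2Space (N.Hull E) := by
  have : T1Space (N.Hull E) := by
    refine withSeminorms_hull.T1_of_separating fun ξ hξ => ?_
    obtain ⟨a, rfl⟩ := cls_surjective ξ
    by_contra! H
    refine hξ (cls_eq_cls (b := 0) |>.2 ?_)
    intro p hp r hr
    have := eventually_lt_of_hullSeminorm_lt hp (a := a - 0) (r := r) (by
      rw [sub_zero, H ⟨p, hp⟩]; exact hr)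
    change Star.map p (a - 0 : N.finitePart E).1 ∈ _
    obtain ⟨s, hs, h⟩ := (a - 0 : N.finitePart E).1.exists_rep
    rw [h, Star.map_mk, mk_mem_starSet] at this ⊢
    exact this.mono fun i hi => (abs_of_nonneg (apply_nonneg p (s i))).trans_lt hi
  infer_instance

theorem isOpen_hullSet {U : Set E} (P : BallPresentation.{u, x} U) : IsOpen (N.hullSet P) := by
  refine isOpen_iUnion fun i => isOpen_iInter_of_finite fun j => ?_
  have := withSeminorms_hull (N := N).continuous_seminorm ⟨P.p i j, P.continuous_p i j⟩
  exact isOpen_lt (this.comp (continuous_id.sub continuous_const)) continuous_const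

/-- The strict inequalities between standard parts that define `Û` are unaffected by infinitesimal
changes, and imply the strict inequalities that define `U*`. -/
theorem mem_starInterior_of_mem_hullSet {U : Set E} {P : BallPresentation.{u, x} U}
    {a : N.finitePart E} (ha : cls a ∈ N.hullSet P) : a.1 ∈ N.starInterior U := by
  have key : ∀ b : N.finitePart E, cls b ∈ N.hullSet P → b.1 ∈ N.starSet U := fun b hb => by
    rw [hullSet, Set.mem_iUnion] at hb
    obtain ⟨i, hi⟩ := hb
    obtain ⟨s, hs, hbs⟩ := b.1.exists_rep
    have h1 : ∀ j, ∀ᶠ n in (N.D : Filter N.ι), P.p i j (s n - P.c i j) < P.ε i j := fun j => by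
      have h3 := Set.mem_ofPred.1 (Set.mem_iInter.1 hi j)
      rw [stdCls, ← cls_sub] at h3
      have h2 : Star.map (P.p i j) (b.1 - N.std (P.c i j)) ∈ N.starSet (Set.Iio (P.ε i j)) :=
        eventually_lt_of_hullSeminorm_lt (P.continuous_p i j) h3
      rw [hbs] at h2
      exact h2
    rw [hbs, mk_mem_starSet]
    filter_upwards [eventually_all.2 h1] with n hn
    rw [P.eq_iUnion]
    exact Set.mem_iUnion.2 ⟨i, Set.mem_iInter.2 hn⟩
  refine ⟨key a ha, fun b hb => ?_⟩
  have hbf := hb.mem_finitePart a.2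
  refine key ⟨b, hbf⟩ ?_
  rwa [(cls_eq_cls (a := ⟨b, hbf⟩)).2 hb]

end Hull

end NonstandardExtension

/-! ### Generalities on Bastiani differentiability -/

section Bastiani

variable {X : Type u} {Y : Type v} [AddCommGroup X] [Module ℝ X] [TopologicalSpace X]
  [AddCommGroup Y] [Module ℝ Y] [TopologicalSpace Y]

theorem IsBastianiCk.of_le {k k' : ℕ} (hk : k ≤ k') {g : X → Y} {V : Set X}
    (h : IsBastianiCk k' g V) : IsBastianiCk k g V := by
  obtain ⟨D, hD⟩ := h
  exact ⟨D, hD.zero, fun j hj => hD.succ j (hj.trans_le hk), fun j hj => hD.cont j (hj.trans hk)⟩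

theorem eventually_add_smul_mem [ContinuousAdd X] [ContinuousSMul ℝ X] {V : Set X} (hV : IsOpen V)
    {a : X} (ha : a ∈ V) (y : X) : ∀ᶠ t : ℝ in 𝓝 0, a + t • y ∈ V := by
  have hc : Continuous fun t : ℝ => a + t • y := by fun_prop
  exact hc.continuousAt.eventually_mem (by simpa using hV.mem_nhds ha)

/-- The values of the iterated derivatives are determined by the map, by uniqueness of limits. -/
theorem HasBastianiDerivs.unique [ContinuousAdd X] [ContinuousSMul ℝ X] [T2Space Y] {k : ℕ}
    {g : X → Y} {V : Set X} (hV : IsOpen V) {D D' : (j : ℕ) → X → (Fin j → X) → Y}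
    (hD : HasBastianiDerivs k g V D) (hD' : HasBastianiDerivs k g V D') {j : ℕ} (hj : j ≤ k) :
    ∀ a ∈ V, ∀ h, D j a h = D' j a h := by
  induction j with
  | zero => exact fun a ha h => (hD.zero a ha h).trans (hD'.zero a ha h).symm
  | succ j ih =>
    intro a ha h
    have ih := ih (Nat.le_of_succ_le hj)
    rw [← Fin.snoc_init_self h]
    refine tendsto_nhds_unique (hD.succ j hj a ha _ _)
      ((hD'.succ j hj a ha (Fin.init h) (h (Fin.last j))).congr' ?_)
    filter_upwards [nhdsWithin_le_nhds (eventually_add_smul_mem hV ha (h (Fin.last j)))] with t ht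
    rw [ih _ ht, ih a ha]

end Bastiani

namespace NonstandardExtension

variable {N : NonstandardExtension.{w}}
variable {E : Type u} [AddCommGroup E] [Module ℝ E] [TopologicalSpace E]
variable {F : Type v} [AddCommGroup F] [Module ℝ F] [TopologicalSpace F]

/-! ### The induced maps on the nonstandard hull -/

section Induced

theorem snoc_map {X Y : Type*} (g : X → Y) {j : ℕ} (h : Fin j → X) (y : X) :
    (Fin.snoc (fun l => g (h l)) (g y) : Fin (j + 1) → Y) =
      fun l => g ((Fin.snoc h y : Fin (j + 1) → X) l) :=
  (Fin.comp_snoc g h y).symm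

open Classical in
/-- The map `Ê × Ê ^ j → F̂` induced by `T : E → Lin^j(E, F)`. It is computed on chosen
representatives of the classes, with value `0` where `T` takes these to a point that is not
finite. -/
noncomputable def hullMap {j : ℕ} (T : E → MultilinearMap ℝ (fun _ : Fin j => E) F) (α : N.Hull E)
    (η : Fin j → N.Hull E) : N.Hull F :=
  if hb : evalStar T (Function.surjInv cls_surjective α).1
      (fun l => (Function.surjInv cls_surjective (η l)).1) ∈ N.finitePart F
    then cls ⟨_, hb⟩ else 0

theorem near_surjInv (a : N.finitePart E) :
    Near (Function.surjInv cls_surjective (cls a)).1 a.1 :=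
  cls_eq_cls.1 (Function.surjInv_eq _ _)

variable {κ : Cardinal.{u}} {k : ℕ} {f : E → F} {U : Set E} {P : BallPresentation.{u, x} U}
  {d : (j : ℕ) → E → MultilinearMap ℝ (fun _ : Fin j => E) F}

theorem HasUniformDerivs.evalStar_coe_mem_finitePart (hf : N.IsFiniteOn f U)
    (hd : N.HasUniformDerivs k f U d) {j : ℕ} (hj : j ≤ k) {a : N.finitePart E}
    (ha : cls a ∈ N.hullSet P) (h : Fin j → N.finitePart E) :
    evalStar (d j) a.1 (fun l => (h l).1) ∈ N.finitePart F :=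
  hd.evalStar_mem_finitePart hf hj (mem_starInterior_of_mem_hullSet ha) a.2 fun l => (h l).2

/-- On `Û` the map induced by `d j` does not depend on the choice of representatives. -/
theorem HasUniformDerivs.hullMap_cls (hκ : ℵ₀ < κ)
    (hE : #{p : Seminorm ℝ E // Continuous p} < κ) (hN : N.IsSaturated κ) (hf : N.IsFiniteOn f U)
    (hk : 1 ≤ k) (hd : N.HasUniformDerivs k f U d) {j : ℕ} (hj : j ≤ k) {a : N.finitePart E}
    (ha : cls a ∈ N.hullSet P) (h : Fin j → N.finitePart E) :
    hullMap (d j) (cls a) (fun l => cls (h l)) =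
      cls ⟨_, hd.evalStar_coe_mem_finitePart hf hj ha h⟩ := by
  have hnear := hd.near_evalStar hκ hE hN hf hk hj (mem_starInterior_of_mem_hullSet ha) a.2
    (near_surjInv a) (h := fun l => (h l).1) (fun l => (h l).2) (fun l => near_surjInv (h l))
  have hfin := hnear.mem_finitePart (hd.evalStar_coe_mem_finitePart hf hj ha h)
  rw [hullMap, dif_pos hfin]
  exact cls_eq_cls.2 hnear

/-- The hypothesis concerns positive infinitesimals only, so overspill gives the one-sided
derivative. -/
theorem HasUniformDerivs.tendsto_nhdsGT (hκ : ℵ₀ < κ)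
    (hE : #{p : Seminorm ℝ E // Continuous p} < κ) (hN : N.IsSaturated κ) (hf : N.IsFiniteOn f U)
    (hk : 1 ≤ k) (hd : N.HasUniformDerivs k f U d) {j : ℕ} (hj : j < k) {a : N.finitePart E}
    (ha : cls a ∈ N.hullSet P) (h : Fin j → N.finitePart E) (y : N.finitePart E) :
    Tendsto (fun t : ℝ => t⁻¹ • (hullMap (d j) (cls a + t • cls y) (fun l => cls (h l)) -
      hullMap (d j) (cls a) fun l => cls (h l))) (𝓝[>] 0)
      (𝓝 (hullMap (d (j + 1)) (cls a) (Fin.snoc (fun l => cls (h l)) (cls y)))) := by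
  rw [withSeminorms_hull.tendsto_nhds]
  rintro ⟨q, hq⟩ ε hε
  obtain ⟨r, hr, hlt⟩ := exists_pos_lt_of_near hκ hE hN
    (hd.succ j hj a.1 (mem_starInterior_of_mem_hullSet ha) a.2 y.1 y.2 (fun l => (h l).1)
      fun l => (h l).2) hq (half_pos hε)
  filter_upwards [Ioo_mem_nhdsGT hr, nhdsWithin_le_nhds
    (eventually_add_smul_mem (isOpen_hullSet P) ha (cls y))] with t ht hmem
  rw [← cls_smul, ← cls_add] at hmem ⊢
  rw [snoc_map cls, hd.hullMap_cls hκ hE hN hf hk hj.le hmem,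
    hd.hullMap_cls hκ hE hN hf hk hj.le ha,
    hd.hullMap_cls hκ hE hN hf hk hj ha, ← cls_sub, ← cls_smul, ← cls_sub]
  refine (hullSeminorm_le_of_eventually_lt hq ?_).trans_lt (half_lt_self hε)
  have := hlt t ht.1 ht.2
  rw [snoc_map Subtype.val] at this
  exact this

theorem HasUniformDerivs.hullMap_snoc_neg (hκ : ℵ₀ < κ)
    (hE : #{p : Seminorm ℝ E // Continuous p} < κ) (hN : N.IsSaturated κ) (hf : N.IsFiniteOn f U)
    (hk : 1 ≤ k) (hd : N.HasUniformDerivs k f U d) {j : ℕ} (hj : j < k) {a : N.finitePart E}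
    (ha : cls a ∈ N.hullSet P) (h : Fin j → N.finitePart E) (y : N.finitePart E) :
    hullMap (d (j + 1)) (cls a) (Fin.snoc (fun l => cls (h l)) (-cls y)) =
      -hullMap (d (j + 1)) (cls a) (Fin.snoc (fun l => cls (h l)) (cls y)) := by
  rw [← cls_neg, snoc_map cls, snoc_map cls, hd.hullMap_cls hκ hE hN hf hk hj ha,
    hd.hullMap_cls hκ hE hN hf hk hj ha, ← cls_neg]
  congr 1
  apply Subtype.ext
  change evalStar (d (j + 1)) a.1 _ = -evalStar (d (j + 1)) a.1 _
  rw [← snoc_map Subtype.val, ← snoc_map Subtype.val]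
  exact evalStar_snoc_neg _ _ _ _

theorem HasUniformDerivs.continuousOn_hullMap (hκ : ℵ₀ < κ)
    (hE : #{p : Seminorm ℝ E // Continuous p} < κ) (hN : N.IsSaturated κ) (hf : N.IsFiniteOn f U)
    (hk : 1 ≤ k) (hd : N.HasUniformDerivs k f U d) {j : ℕ} (hj : j ≤ k) :
    ContinuousOn (fun z : N.Hull E × (Fin j → N.Hull E) => hullMap (d j) z.1 z.2)
      (N.hullSet P ×ˢ Set.univ) := by
  rintro ⟨α, η⟩ ⟨hα, -⟩
  obtain ⟨a, rfl⟩ := cls_surjective α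
  obtain ⟨h, rfl⟩ := cls_surjective.comp_left η
  rw [ContinuousWithinAt, withSeminorms_hull.tendsto_nhds]
  rintro ⟨q, hq⟩ ε hε
  obtain ⟨p, hp, r, hr, hlt⟩ := exists_seminorm_lt_of_near hκ hE hN (fun b h' hb hh' =>
    hd.near_evalStar hκ hE hN hf hk hj (mem_starInterior_of_mem_hullSet hα) a.2 hb
      (fun l => (h l).2) hh') hq (half_pos hε)
  have hcont : Continuous (hullSeminorm (N := N) p hp) :=
    withSeminorms_hull.continuous_seminorm ⟨p, hp⟩
  have h1 : ∀ᶠ z : N.Hull E × (Fin j → N.Hull E) in 𝓝 (cls a, cls ∘ h),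
      hullSeminorm p hp (z.1 - cls a) < r := by
    have hc : Continuous fun z : N.Hull E × (Fin j → N.Hull E) =>
        hullSeminorm p hp (z.1 - cls a) := by fun_prop
    exact hc.continuousAt.eventually_lt continuousAt_const (by simpa using hr)
  have h2 : ∀ᶠ z : N.Hull E × (Fin j → N.Hull E) in 𝓝 (cls a, cls ∘ h),
      ∀ l, hullSeminorm p hp (z.2 l - cls (h l)) < r := by
    refine eventually_all.2 fun l => ?_
    have hc : Continuous fun z : N.Hull E × (Fin j → N.Hull E) =>
        hullSeminorm p hp (z.2 l - cls (h l)) := by fun_prop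
    exact hc.continuousAt.eventually_lt continuousAt_const (by simpa using hr)
  filter_upwards [nhdsWithin_le_nhds h1, nhdsWithin_le_nhds h2, self_mem_nhdsWithin]
  rintro ⟨β, θ⟩ h1 h2 ⟨hβ, -⟩
  obtain ⟨b, rfl⟩ := cls_surjective β
  obtain ⟨g, rfl⟩ := cls_surjective.comp_left θ
  have e1 := hd.hullMap_cls hκ hE hN hf hk hj hβ g
  have e2 := hd.hullMap_cls hκ hE hN hf hk hj hα h
  change hullSeminorm q hq (hullMap (d j) (cls b) (fun l => cls (g l)) -
    hullMap (d j) (cls a) (fun l => cls (h l))) < ε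
  rw [e1, e2, ← cls_sub]
  refine (hullSeminorm_le_of_eventually_lt hq ?_).trans_lt (half_lt_self hε)
  refine hlt b.1 (fun l => (g l).1) ?_ fun l => ?_
  · exact eventually_lt_of_hullSeminorm_lt hp (a := b - a) (by rw [cls_sub]; exact h1)
  · exact eventually_lt_of_hullSeminorm_lt hp (a := g l - h l)
      (by rw [cls_sub]; exact h2 l)

theorem HasUniformDerivs.hasBastianiDerivs (hκ : ℵ₀ < κ)
    (hE : #{p : Seminorm ℝ E // Continuous p} < κ) (hN : N.IsSaturated κ) (hf : N.IsFiniteOn f U)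
    (hk : 1 ≤ k) (hd : N.HasUniformDerivs k f U d) {g : N.Hull E → N.Hull F}
    (hg : IsInducedMap f (N.hullSet P) g) :
    HasBastianiDerivs k g (N.hullSet P) fun j => hullMap (d j) where
  zero α hα η := by
    obtain ⟨a, rfl⟩ := cls_surjective α
    obtain ⟨h, rfl⟩ := cls_surjective.comp_left η
    obtain ⟨hb, hgb⟩ := hg a hα
    rw [hgb]
    refine (hd.hullMap_cls hκ hE hN hf hk k.zero_le hα h).trans (congrArg cls (Subtype.ext ?_))
    exact evalStar_zero (d 0) hd.zero (mem_starInterior_of_mem_hullSet hα).1 _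
  succ j hj α hα η ζ := by
    obtain ⟨a, rfl⟩ := cls_surjective α
    obtain ⟨h, rfl⟩ := cls_surjective.comp_left η
    obtain ⟨y, rfl⟩ := cls_surjective ζ
    rw [← nhdsLT_sup_nhdsGT, tendsto_sup]
    refine ⟨?_, hd.tendsto_nhdsGT hκ hE hN hf hk hj hα h y⟩
    -- The limit from the left is the negative of the limit from the right in the direction `-y`.
    have h1 := (hd.tendsto_nhdsGT hκ hE hN hf hk hj hα h (-y)).neg
    rw [cls_neg, hd.hullMap_snoc_neg hκ hE hN hf hk hj hα h y, neg_neg] at h1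
    have hneg : Tendsto (fun t : ℝ => -t) (𝓝[<] 0) (𝓝[>] 0) := by
      simpa using tendsto_neg_nhdsLT (a := (0 : ℝ))
    refine (h1.comp hneg).congr fun t => ?_
    simp only [Function.comp_apply, neg_smul, smul_neg, neg_neg, inv_neg]
    rfl
  cont j hj := hd.continuousOn_hullMap hκ hE hN hf hk hj

theorem HasUniformDerivs.exists_isInducedMap (hκ : ℵ₀ < κ)
    (hE : #{p : Seminorm ℝ E // Continuous p} < κ) (hN : N.IsSaturated κ) (hf : N.IsFiniteOn f U)
    (hk : 1 ≤ k) (hd : N.HasUniformDerivs k f U d) (P : BallPresentation.{u, x} U) :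
    ∃ g : N.Hull E → N.Hull F, IsInducedMap f (N.hullSet P) g := by
  refine ⟨fun α => hullMap (d 0) α fun _ => cls 0, fun a ha => ?_⟩
  have hU := mem_starInterior_of_mem_hullSet ha
  refine ⟨hf a.1 hU.1 a.2, ?_⟩
  refine (hd.hullMap_cls hκ hE hN hf hk k.zero_le ha _).trans (congrArg cls (Subtype.ext ?_))
  exact evalStar_zero (d 0) hd.zero hU.1 _

end Induced

end NonstandardExtension

theorem propositionL {E : Type u} [AddCommGroup E] [Module ℝ E] [TopologicalSpace E]
    [IsTopologicalAddGroup E] [ContinuousSMul ℝ E] [LocallyConvexSpace ℝ E]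
    {F : Type v} [AddCommGroup F] [Module ℝ F] [TopologicalSpace F]
    [IsTopologicalAddGroup F] [ContinuousSMul ℝ F] [LocallyConvexSpace ℝ F]
    (N : NonstandardExtension.{w}) (κ : Cardinal.{u}) (hκ : ℵ₀ < κ)
    (hE : #{p : Seminorm ℝ E // Continuous p} < κ) (hN : N.IsSaturated κ)
    (U : Set E) (hU : IsOpen U) (P : BallPresentation.{u, x} U)
    (f : E → F) (hf : N.IsFiniteOn f U) :
    (∀ k : ℕ, 1 ≤ k → ∀ d : (j : ℕ) → E → MultilinearMap ℝ (fun _ : Fin j => E) F,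
      N.HasUniformDerivs k f U d →
        (∃ fhat : N.Hull E → N.Hull F,
          NonstandardExtension.IsInducedMap f (N.hullSet P) fhat) ∧
        ∀ fhat : N.Hull E → N.Hull F, NonstandardExtension.IsInducedMap f (N.hullSet P) fhat →
          IsBastianiCk k fhat (N.hullSet P) ∧
          ∀ dhat : (j : ℕ) → N.Hull E → (Fin j → N.Hull E) → N.Hull F,
            HasBastianiDerivs k fhat (N.hullSet P) dhat →
            ∀ a : N.finitePart E, NonstandardExtension.cls a ∈ N.hullSet P →
            ∀ h : Fin k → N.finitePart E,
              ∃ hb : NonstandardExtension.evalStar (d k) a.1 (fun i => (h i).1) ∈ N.finitePart F,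
                dhat k (NonstandardExtension.cls a) (fun i => NonstandardExtension.cls (h i)) =
                  NonstandardExtension.cls ⟨_, hb⟩) ∧
    (N.IsUniformlySmooth f U →
      (∃ fhat : N.Hull E → N.Hull F,
        NonstandardExtension.IsInducedMap f (N.hullSet P) fhat) ∧
      ∀ fhat : N.Hull E → N.Hull F, NonstandardExtension.IsInducedMap f (N.hullSet P) fhat →
        IsBastianiSmooth fhat (N.hullSet P)) := by
  refine ⟨fun k hk d hd => ⟨hd.exists_isInducedMap hκ hE hN hf hk P, fun g hg => ?_⟩, fun hs => ?_⟩
  · have hB := hd.hasBastianiDerivs hκ hE hN hf hk hg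
    refine ⟨⟨_, hB⟩, fun D hD a ha h => ⟨hd.evalStar_coe_mem_finitePart hf le_rfl ha h, ?_⟩⟩
    rw [hD.unique (NonstandardExtension.isOpen_hullSet P) hB le_rfl _ ha]
    exact hd.hullMap_cls hκ hE hN hf hk le_rfl ha h
  · obtain ⟨d, hd⟩ := hs 1 le_rfl
    refine ⟨hd.exists_isInducedMap hκ hE hN hf le_rfl P, fun g hg k => ?_⟩
    obtain ⟨d, hd⟩ := hs (k + 1) (Nat.le_add_left 1 k)
    have hB := hd.hasBastianiDerivs hκ hE hN hf (Nat.le_add_left 1 k) hg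
    exact IsBastianiCk.of_le k.le_succ ⟨_, hB⟩
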